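/- Let $\mathcal X,\mathcal Y$ be measurable spaces, let $L:\mathcal Y\times\mathcal Y\to[0,1]$ be a measurable loss function, and let $\mathcal C$ be a class of measurable predictors $\phi:\mathcal X\to\mathcal Y$. For a collection $\mathcal A$ of subsets of $\mathcal X\times\mathcal Y$, the shatter coefficient $\mathcal S(m,\mathcal A)$ is the maximum over $z_1,\dots,z_m$ of the number of different sets $\{z_1,\dots,z_m\}\cap A$, $A\in\mathcal A$, and the VC dimension of $\mathcal A$ is the largest $m$ with $\mathcal S(m,\mathcal A)=2^m$. Assume that $\mathcal C$ has finite VC dimension $V$, i.e. that the collection of the sets $\{(x,y): L(y,\phi(x))>t\}$, $\phi\in\mathcal C$, $t\in[0,1]$, has VC dimension $V<\infty$. Let $\Phi$ be a learning algorithm, that is, for every sample size $m$ a map which is jointly measurable in the sample in $(\mathcal X\times\mathcal Y)^m$ and the point $x\in\mathcal X$, with values in $\mathcal Y$. Assume that $\Phi$ does not depend on the order of the observations of the training sample and that it is an empirical risk minimizer over $\mathcal C$: on every nonempty sample, the trained predictor belongs to $\mathcal C$ and attains the minimum over $\mathcal C$ of the average loss on that sample. Let $\mathcal D_n=((X_i,Y_i))_{1\le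 i\le n}$, $n\ge1$, be i.i.d. with law $\mathbb P$, let $k\ge2$ be an integer dividing $n$, and put $p_n=1/k$. Split $\{1,\dots,n\}$ into $k$ consecutive folds $F_1,\dots,F_k$ of size $np_n=n/k$, and let $\phi_{-j}$ be the predictor trained by $\Phi$ on the $n(1-p_n)$ observations with index outside $F_j$. Write $R(\phi)=\mathbb E_{(X,Y)\sim\mathbb P}\,L(Y,\phi(X))$ and $$\widehat R_{CV}=\frac1k\sum_{j=1}^k\frac{1}{np_n}\sum_{i\in F_j}L(Y_i,\phi_{-j}(X_i)),\qquad \bar R_{n(1-p)}=\frac1k\sum_{j=1}^k R(\phi_{-j}).$$ Then for every $\varepsilon>0$, $$\Pr\big(\widehat R_{CV}-\bar R_{n(1-p)}\ge\varepsilon\big)\le 2^{1/p_n}\exp\left(-\frac{n\varepsilon^2}{64\left(\sqrt{V\ln(2(2np_n+1))}+2\right)^2}\right),$$ and likewise $$\Pr\big(\bar R_{n(1-p)}-\widehat R_{CV}\ge\varepsilon\big)\le 2^{1/p_n}\exp\left(-\frac{n\varepsilon^2}{64\left(\sqrt{V\ln(2(2np_n+1))}+2\right)^2}\right).$$ -/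

import Mathlib

open MeasureTheory ProbabilityTheory

noncomputable section

namespace CrossVal

/-! ### Shatter coefficients and VC dimension -/

section VC

variable {Z : Type*}

/-- The number of different sets `{z₁, …, zₘ} ∩ A`, for `A` in the collection `𝒜`. -/
def traceCount (𝒜 : Set (Set Z)) {m : ℕ} (z : Fin m → Z) : ℕ∞ :=
  ((fun A : Set Z => Set.range z ∩ A) '' 𝒜).encard

/-- The `m`-th shatter coefficient: the maximal number of different subsets of `m` points that
can be picked out by the collection `𝒜`. -/
def shatterCoeff (𝒜 : Set (Set Z)) (m : ℕ) : ℕ∞ :=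
  ⨆ z : Fin m → Z, traceCount 𝒜 z

/-- The VC dimension: the largest `m` with `m`-th shatter coefficient `2 ^ m`, and `⊤` if there is
no largest one. (It is `0` for a collection with a single set.) -/
def vcDim (𝒜 : Set (Set Z)) : ℕ∞ :=
  ⨆ (m : ℕ) (_ : shatterCoeff 𝒜 m = 2 ^ m), (m : ℕ∞)

end VC

/-! ### Losses, risks and learning algorithms -/

section Learning

variable {𝒳 𝒴 : Type*}

/-- The loss of the predictor `φ` at the observation `z = (x, y)`, that is `L (y, φ x)`. -/
def lossAt (L : 𝒴 → 𝒴 → ℝ) (φ : 𝒳 → 𝒴) (z : 𝒳 × 𝒴) : ℝ := L z.2 (φ z.1)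

/-- The collection of the sets `{(x, y) | L (y, φ x) > t}`, for `φ` in the class `C` and
`t ∈ [0, 1]`. -/
def lossSets (L : 𝒴 → 𝒴 → ℝ) (C : Set (𝒳 → 𝒴)) : Set (Set (𝒳 × 𝒴)) :=
  {A | ∃ φ ∈ C, ∃ t ∈ Set.Icc (0 : ℝ) 1, A = {z | t < lossAt L φ z}}

/-- The VC dimension of a class of predictors (relative to the loss `L`). -/
def classVCDim (L : 𝒴 → 𝒴 → ℝ) (C : Set (𝒳 → 𝒴)) : ℕ∞ := vcDim (lossSets L C)

/-- The risk (generalization error) `E L(Y, φ(X))` of a fixed predictor, with `(X, Y) ∼ P`. -/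
def risk [MeasurableSpace 𝒳] [MeasurableSpace 𝒴] (P : Measure (𝒳 × 𝒴)) (L : 𝒴 → 𝒴 → ℝ)
    (φ : 𝒳 → 𝒴) : ℝ := ∫ z, lossAt L φ z ∂P

/-- The weighted empirical error of `φ`: the average loss over the observations of `d` selected
by a binary vector. A binary vector is represented by the set `s` of the indices of its ones. -/
def weightedRisk (L : 𝒴 → 𝒴 → ℝ) {n : ℕ} (d : Fin n → 𝒳 × 𝒴) (s : Finset (Fin n))
    (φ : 𝒳 → 𝒴) : ℝ := (∑ i ∈ s, lossAt L φ (d i)) / (s.card : ℝ)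

/-- The empirical risk of `φ` on the whole sample `d`. -/
def empRisk (L : 𝒴 → 𝒴 → ℝ) {n : ℕ} (d : Fin n → 𝒳 × 𝒴) (φ : 𝒳 → 𝒴) : ℝ :=
  weightedRisk L d Finset.univ φ

/-- The subsample of `d` selected by `s` (in the order of the indices). -/
def subsample {n : ℕ} (d : Fin n → 𝒳 × 𝒴) (s : Finset (Fin n)) : Fin s.card → 𝒳 × 𝒴 :=
  fun j => d (s.orderEmbOfFin rfl j)

/-- A learning algorithm: for every sample size `m` it maps a sample of size `m` and a point `x`
to the prediction at `x`. -/
abbrev Algorithm (𝒳 𝒴 : Type*) := (m : ℕ) → (Fin m → 𝒳 × 𝒴) → 𝒳 → 𝒴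

/-- The algorithm is a measurable map of the sample and the point jointly. -/
def Algorithm.IsMeasurable [MeasurableSpace 𝒳] [MeasurableSpace 𝒴] (Φ : Algorithm 𝒳 𝒴) : Prop :=
  ∀ m : ℕ, Measurable fun q : (Fin m → 𝒳 × 𝒴) × 𝒳 => Φ m q.1 q.2

/-- The predictor does not depend on the order of the observations of the training sample. -/
def Algorithm.IsSymmetric (Φ : Algorithm 𝒳 𝒴) : Prop :=
  ∀ (m : ℕ) (d : Fin m → 𝒳 × 𝒴) (σ : Equiv.Perm (Fin m)), Φ m (d ∘ σ) = Φ m d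

/-- The algorithm is an empirical risk minimizer over the class `C`: on every (nonempty) sample its
predictor belongs to `C` and attains the minimum over `C` of the empirical risk. -/
def Algorithm.IsERM (Φ : Algorithm 𝒳 𝒴) (L : 𝒴 → 𝒴 → ℝ) (C : Set (𝒳 → 𝒴)) : Prop :=
  ∀ m : ℕ, 0 < m → ∀ d : Fin m → 𝒳 × 𝒴,
    Φ m d ∈ C ∧ ∀ φ ∈ C, empRisk L d (Φ m d) ≤ empRisk L d φ

/-- The predictor trained on the subsample of `d` selected by `s`. -/
def Algorithm.trainedOn (Φ : Algorithm 𝒳 𝒴) {n : ℕ} (d : Fin n → 𝒳 × 𝒴) (s : Finset (Fin n)) :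
    𝒳 → 𝒴 := Φ s.card (subsample d s)

/-! ### Cross-validation -/

/-- The expectation of `f` over a random training vector with law `ν`. -/
def expTrain {n : ℕ} (ν : PMF (Finset (Fin n))) (f : Finset (Fin n) → ℝ) : ℝ :=
  ∑ s, (ν s).toReal * f s

/-- The cross-validation estimate, for a random training vector with law `ν` independent of the
data: the predictor is trained on the training sample and tested on its complement. -/
def cvEstimate (L : 𝒴 → 𝒴 → ℝ) (Φ : Algorithm 𝒳 𝒴) {n : ℕ} (ν : PMF (Finset (Fin n)))
    (d : Fin n → 𝒳 × 𝒴) : ℝ :=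
  expTrain ν fun s => weightedRisk L d sᶜ (Φ.trainedOn d s)

/-- The cross-validation risk: the expectation, over the training vector only, of the risk of the
predictor trained on the training sample. -/
def cvRisk [MeasurableSpace 𝒳] [MeasurableSpace 𝒴] (P : Measure (𝒳 × 𝒴)) (L : 𝒴 → 𝒴 → ℝ)
    (Φ : Algorithm 𝒳 𝒴) {n : ℕ} (ν : PMF (Finset (Fin n))) (d : Fin n → 𝒳 × 𝒴) : ℝ :=
  expTrain ν fun s => risk P L (Φ.trainedOn d s)

/-- The `j`-th of the `k` consecutive folds of size `n / k` of `{0, …, n - 1}`. -/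
def fold (n k : ℕ) (j : Fin k) : Finset (Fin n) :=
  Finset.univ.filter fun i => i.val / (n / k) = j.val

/-- The law of the training vector of `k`-fold cross-validation: the test sample is one of the `k`
folds, each with probability `1 / k`, and the training sample is its complement. -/
def kFoldLaw (n k : ℕ) [NeZero k] : PMF (Finset (Fin n)) :=
  (PMF.uniformOfFintype (Fin k)).map fun j => (fold n k j)ᶜ

end Learning

end CrossVal

end

/-! Write `m = n / k`. Each predictor is independent of the fold that tests it, but predictors of
different folds share data, so the `k` fold deviations are dependent. The cure is to dominate the
exponential of each deviation by a quantity that sees its own fold only.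

By Jensen, an independent ghost sample replaces the true risks inside the exponential, which then
factors over the folds. In each factor the predictor gives way to the worst one, an essential
supremum over training samples (`blockExp_le_blockSup_ae`); unlike a plain supremum over an
uncountable family, it is measurable. The new factor depends only on the pairs (observation, ghost)
of its fold.

Exchanging the members of pairs preserves the law and produces independent random signs. With the
pairs fixed, only the traces of the loss sets at `2m` points matter (`exists_threshold`);
Sauer–Shelah allows at most `(2m+1)^V` of them, and each has Rademacher moment at most `exp(mθ²/2)`.
So the whole exponential moment is at most `((2m+1)^V exp(mθ²/2))^k` (`lintegral_prod_blockSup_le`).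
Chernoff with `θ = ±ε` then beats the stated bound whenever the latter is below one. -/

noncomputable section

namespace CrossVal

/-! ### Sauer–Shelah for traces of a collection of sets -/

section Shatter

variable {Z : Type*}

theorem traceCount_le_two_pow (𝒜 : Set (Set Z)) {m : ℕ} (z : Fin m → Z) :
    traceCount 𝒜 z ≤ 2 ^ m := by
  classical
  have h : (fun A : Set Z => Set.range z ∩ A) '' 𝒜 ⊆
      (fun T : Finset (Fin m) => z '' T) '' Set.univ := by
    rintro _ ⟨A, -, rfl⟩
    refine ⟨Finset.univ.filter fun i => z i ∈ A, trivial, ?_⟩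
    ext x
    simp only [Finset.coe_filter, Finset.mem_univ, true_and, Set.mem_image, Set.mem_ofPred_eq,
      Set.mem_inter_iff, Set.mem_range]
    constructor
    · rintro ⟨i, hi, rfl⟩
      exact ⟨⟨i, rfl⟩, hi⟩
    · rintro ⟨⟨i, rfl⟩, hi⟩
      exact ⟨i, hi, rfl⟩
  refine (Set.encard_le_encard h).trans ((Set.encard_image_le _ _).trans ?_)
  rw [Set.encard_univ, ENat.card_eq_coe_fintype_card]
  simp

/-- The subsets of the index type `κ` picked out by the collection `𝒜` at the points `z`. -/
def traces (𝒜 : Set (Set Z)) {κ : Type*} [Fintype κ] (z : κ → Z) : Finset (Finset κ) :=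
  open Classical in Finset.univ.filter fun T => ∃ A ∈ 𝒜, ∀ i, i ∈ T ↔ z i ∈ A

theorem mem_traces {𝒜 : Set (Set Z)} {κ : Type*} [Fintype κ] {z : κ → Z} {T : Finset κ} :
    T ∈ traces 𝒜 z ↔ ∃ A ∈ 𝒜, ∀ i, i ∈ T ↔ z i ∈ A := by
  simp [traces]

theorem shatterCoeff_eq_of_shatters {𝒜 : Set (Set Z)} {κ : Type*} [Fintype κ] [DecidableEq κ]
    {z : κ → Z} {s : Finset κ} (hs : (traces 𝒜 z).Shatters s) :
    shatterCoeff 𝒜 s.card = 2 ^ s.card := by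
  classical
  refine le_antisymm (iSup_le fun z => traceCount_le_two_pow 𝒜 z) ?_
  refine le_trans ?_ (le_iSup _ fun j => z (s.equivFin.symm j))
  set R := Set.range fun j => z (s.equivFin.symm j) with hR
  -- Every subset of `s` is recovered from some `R ∩ A`, so there are at least `2 ^ s.card` such
  -- sets; injectivity of `z` is not needed.
  have h : (s.powerset : Set (Finset κ)) ⊆
      (fun B : Set Z => s.filter fun i => z i ∈ B) '' ((fun A : Set Z => R ∩ A) '' 𝒜) := by
    intro t ht
    obtain ⟨u, hu, rfl⟩ := hs (Finset.mem_powerset.1 ht)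
    obtain ⟨A, hA, hAu⟩ := mem_traces.1 hu
    refine ⟨_, ⟨A, hA, rfl⟩, ?_⟩
    ext i
    simp only [Finset.mem_filter, Set.mem_inter_iff, Finset.mem_inter, hAu]
    refine ⟨fun h => ⟨h.1, h.2.2⟩, fun h => ⟨h.1, ⟨s.equivFin ⟨i, h.1⟩, by simp⟩, h.2⟩⟩
  have h2 := (Set.encard_le_encard h).trans (Set.encard_image_le _ _)
  rw [Set.encard_coe_eq_coe_finsetCard, Finset.card_powerset] at h2
  exact_mod_cast h2

/-- The Sauer–Shelah bound on the number of traces. -/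
theorem card_traces_le {𝒜 : Set (Set Z)} {V : ℕ} (hV : vcDim 𝒜 = V) {κ : Type*} [Fintype κ]
    (z : κ → Z) : (traces 𝒜 z).card ≤ (Fintype.card κ + 1) ^ V := by
  classical
  have hdim : (traces 𝒜 z).vcDim ≤ V := by
    refine Finset.sup_le fun s hs => ?_
    have h1 : (s.card : ℕ∞) ≤ vcDim 𝒜 :=
      le_iSup₂ (f := fun (m : ℕ) (_ : shatterCoeff 𝒜 m = 2 ^ m) => (m : ℕ∞)) s.card
        (shatterCoeff_eq_of_shatters (Finset.mem_shatterer.1 hs))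
    rw [hV] at h1
    exact_mod_cast h1
  calc (traces 𝒜 z).card ≤ (traces 𝒜 z).shatterer.card := Finset.card_le_card_shatterer _
    _ ≤ ∑ i ∈ Finset.Iic (traces 𝒜 z).vcDim, (Fintype.card κ).choose i :=
      Finset.card_shatterer_le_sum_vcDim
    _ ≤ ∑ i ∈ Finset.Iic V, (Fintype.card κ).choose i :=
      Finset.sum_le_sum_of_subset (Finset.Iic_subset_Iic.2 hdim)
    -- Inserting the factors `V.choose i ≥ 1` turns the sum into a binomial expansion.
    _ ≤ ∑ i ∈ Finset.range (V + 1), Fintype.card κ ^ i * V.choose i := by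
      have : Finset.Iic V = Finset.range (V + 1) := by ext; simp
      rw [this]
      refine Finset.sum_le_sum fun i hi => (Nat.choose_le_pow _ _).trans ?_
      exact Nat.le_mul_of_pos_right _ (Nat.choose_pos (Nat.lt_succ_iff.1 (Finset.mem_range.1 hi)))
    _ = (Fintype.card κ + 1) ^ V := by rw [add_pow]; simp

end Shatter

/-! ### From losses to level sets -/

section Threshold

/-- A linear form on `[0, 1]`-valued functions is dominated by its value at the indicator of some
super-level set. -/
theorem exists_threshold {κ : Type*} [Fintype κ] (c v : κ → ℝ) (hv : ∀ i, v i ∈ Set.Icc (0 : ℝ) 1) :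
    ∃ t ∈ Set.Icc (0 : ℝ) 1, ∑ i, c i * v i ≤ ∑ i, c i * (if t < v i then 1 else 0) := by
  -- Layer-cake: `v i` is the average over `t ∈ [0, 1]` of the indicator of `t < v i`, so the form
  -- at `v` is an average over thresholds, and some threshold does at least as well.
  have hint : ∀ i, IntegrableOn (fun t : ℝ => if t < v i then (1 : ℝ) else 0)
      (Set.Icc 0 1) := fun i => by
    refine Measure.integrableOn_of_bounded (M := 1) (by simp)
      (Measurable.ite measurableSet_Iio measurable_const measurable_const).aestronglyMeasurable ?_
    filter_upwards with t
    split_ifs <;> simp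
  have hval : ∀ i, ∫ t in Set.Icc (0 : ℝ) 1, (if t < v i then (1 : ℝ) else 0) = v i := fun i => by
    have h1 : (fun t : ℝ => if t < v i then (1 : ℝ) else 0)
        = (Set.Iio (v i)).indicator fun _ => 1 := by
      ext t; simp [Set.indicator_apply]
    have h2 : (Set.Icc 0 1 ∩ Set.Iio (v i) : Set ℝ) =ᵐ[volume] (Set.Icc 0 (v i) : Set ℝ) := by
      have h3 : (Set.Icc 0 1 ∩ Set.Iio (v i) : Set ℝ) = Set.Ico 0 (v i) := by
        ext t
        simp only [Set.mem_inter_iff, Set.mem_Icc, Set.mem_Iio, Set.mem_Ico]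
        exact ⟨fun h => ⟨h.1.1, h.2⟩, fun h => ⟨⟨h.1, h.2.le.trans (hv i).2⟩, h.2⟩⟩
      rw [h3]
      exact Ico_ae_eq_Icc
    rw [h1, setIntegral_indicator measurableSet_Iio, setIntegral_congr_set h2]
    simp [(hv i).1]
  have hint' : IntegrableOn (fun t : ℝ => ∑ i, c i * (if t < v i then (1 : ℝ) else 0))
      (Set.Icc 0 1) := integrable_finsetSum _ fun i _ => (hint i).const_mul _
  obtain ⟨t, ht, h⟩ := exists_setAverage_le (by simp) (by simp) hint'
  refine ⟨t, ht, ?_⟩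
  rw [average_eq] at h
  rw [integral_finsetSum _ fun i _ => (hint i).const_mul _] at h
  simp only [integral_const_mul, hval,
    measureReal_restrict_apply_univ, Real.volume_real_Icc, sub_zero,
    max_eq_left zero_le_one, inv_one, smul_eq_mul, one_mul] at h
  linarith

end Threshold

/-! ### Random signs from exchanging pairs -/

section Signs

/-- The sign attached to a boolean. -/
def sgn (b : Bool) : ℝ := if b then -1 else 1

/-- Exchange the two coordinates of `w i` at the indices `i` selected by `σ`. -/
def swapAt {ι Z : Type*} (σ : ι → Bool) (w : ι → Z × Z) : ι → Z × Z :=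
  fun i => if σ i then (w i).swap else w i

/-- The value of a pair of coordinates, the first for `true` and the second for `false`. -/
def pairPoints {K Z : Type*} (w : K → Z × Z) (q : K × Bool) : Z :=
  if q.2 then (w q.1).1 else (w q.1).2

/-- The difference of the indicators of a set of indices at the two elements of a pair. -/
def pairDiff {K : Type*} [DecidableEq K] (T : Finset (K × Bool)) (r : K) : ℝ :=
  (if (r, true) ∈ T then 1 else 0) - (if (r, false) ∈ T then 1 else 0)

theorem abs_pairDiff_le {K : Type*} [DecidableEq K] (T : Finset (K × Bool)) (r : K) :
    |pairDiff T r| ≤ 1 := by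
  unfold pairDiff
  split_ifs <;> simp

/-- An exchange flips the sign of a difference, and thresholding replaces losses by indicators. The
traces are taken at the unexchanged points, so the finite family of candidates does not depend on
the signs `τ`. -/
theorem exists_trace_ge {K Z : Type*} [Fintype K] [DecidableEq K] {𝒜 : Set (Set Z)} {f : Z → ℝ}
    (hf : ∀ z, f z ∈ Set.Icc (0 : ℝ) 1) (hf𝒜 : ∀ t ∈ Set.Icc (0 : ℝ) 1, {z | t < f z} ∈ 𝒜)
    (w : K → Z × Z) (τ : K → Bool) (θ : ℝ) :
    ∃ T ∈ traces 𝒜 (pairPoints w),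
      θ * ∑ r, (f (swapAt τ w r).1 - f (swapAt τ w r).2) ≤
        ∑ r, θ * (sgn (τ r) * pairDiff T r) := by
  obtain ⟨t, ht, h⟩ := exists_threshold
    (fun q : K × Bool => θ * sgn (τ q.1) * (if q.2 then 1 else -1)) (fun q => f (pairPoints w q))
    fun q => hf _
  refine ⟨Finset.univ.filter fun q => t < f (pairPoints w q),
    mem_traces.2 ⟨_, hf𝒜 t ht, by simp⟩, ?_⟩
  simp only [Fintype.sum_prod_type, Fintype.sum_bool] at h
  rw [Finset.mul_sum]
  refine le_trans (le_of_eq ?_) (h.trans (le_of_eq ?_))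
  · refine Finset.sum_congr rfl fun r _ => ?_
    simp only [pairPoints, swapAt, sgn]
    cases τ r <;> simp <;> ring
  · refine Finset.sum_congr rfl fun r _ => ?_
    simp only [pairDiff, Finset.mem_filter, Finset.mem_univ, true_and]
    simp only [if_true, Bool.false_eq_true, if_false]
    ring

/-- The exponential moment of a Rademacher sum with coefficients in `[-1, 1]`. -/
theorem sum_exp_sgn_le {K : Type*} [Fintype K] [DecidableEq K] (a : K → ℝ) (ha : ∀ r, |a r| ≤ 1)
    (θ : ℝ) :
    ∑ τ : K → Bool, Real.exp (∑ r, θ * (sgn (τ r) * a r)) ≤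
      (2 * Real.exp (θ ^ 2 / 2)) ^ Fintype.card K := by
  simp_rw [Real.exp_sum]
  rw [← Fintype.piFinset_univ, ← Finset.prod_univ_sum (fun _ : K => (Finset.univ : Finset Bool))
    (fun r b => Real.exp (θ * (sgn b * a r)))]
  rw [← Finset.card_univ]
  rw [← Finset.prod_const]
  refine Finset.prod_le_prod (fun r _ => Finset.sum_nonneg fun b _ => (Real.exp_pos _).le)
    fun r _ => ?_
  have h : ∑ b : Bool, Real.exp (θ * (sgn b * a r)) = 2 * Real.cosh (θ * a r) := by
    rw [Fintype.sum_bool, Real.cosh_eq]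
    simp [sgn]
    ring
  rw [h]
  have h2 : (θ * a r) ^ 2 ≤ θ ^ 2 := by
    rw [mul_pow]
    exact mul_le_of_le_one_right (sq_nonneg _) ((sq_le_one_iff_abs_le_one _).2 (ha r))
  have h3 := (Real.cosh_le_exp_half_sq (θ * a r)).trans
    (Real.exp_le_exp.2 (div_le_div_of_nonneg_right h2 zero_le_two))
  linarith

end Signs

/-! ### Measurability of a parametric essential supremum -/

section EssSup

open scoped ENNReal

/-- The essential supremum exceeds `c` exactly when the section of `{f > c}` has positive measure,
and the measure of a section is measurable in the parameter. -/
theorem measurable_essSup_prod {α β : Type*} [MeasurableSpace α] [MeasurableSpace β]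
    (ν : Measure β) [SFinite ν] {f : α → β → ℝ≥0∞} (hf : Measurable (Function.uncurry f)) :
    Measurable fun a => essSup (f a) ν := by
  refine measurable_of_Ioi fun c => ?_
  have h : (fun a => essSup (f a) ν) ⁻¹' Set.Ioi c =
      (fun a => ν (Prod.mk a ⁻¹' (Function.uncurry f ⁻¹' Set.Ioi c))) ⁻¹' Set.Ioi 0 := by
    ext a
    simp only [Set.mem_preimage, Set.mem_Ioi, pos_iff_ne_zero]
    constructor
    · intro h h0
      refine absurd h (not_lt.2 (essSup_le_of_ae_le c ?_))
      rw [Filter.EventuallyLE, ae_iff]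
      simpa [Set.preimage] using h0
    · intro h
      by_contra hc
      refine h ?_
      have := ENNReal.ae_le_essSup (μ := ν) (f a)
      have h2 : ∀ᵐ b ∂ν, ¬ c < f a b := by
        filter_upwards [this] with b hb using not_lt.2 (hb.trans (not_lt.1 hc))
      rw [ae_iff] at h2
      simpa [Set.preimage] using h2
  rw [h]
  exact measurable_measure_prodMk_left (hf measurableSet_Ioi) measurableSet_Ioi

end EssSup

/-! ### Transformations preserving the law of the pairs -/

section Preserving

variable {ι Z : Type*} [Fintype ι] [MeasurableSpace Z] (P : Measure Z) [IsProbabilityMeasure P]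

theorem measurePreserving_swapAt (σ : ι → Bool) :
    MeasurePreserving (swapAt σ) (Measure.pi fun _ : ι => P.prod P)
      (Measure.pi fun _ : ι => P.prod P) := by
  refine measurePreserving_pi (f := fun i (p : Z × Z) => if σ i then p.swap else p) _ _ fun i => ?_
  cases σ i
  · simpa [Function.id_def] using MeasurePreserving.id (P.prod P)
  · simpa using Measure.measurePreserving_swap

/-- Outside of `B`, replace the first coordinates of `q.1` by `q.2`. -/
def resample (B : Set ι) [DecidablePred (· ∈ B)] (q : (ι → Z × Z) × (ι → Z)) : ι → Z × Z :=
  fun i => if i ∈ B then q.1 i else (q.2 i, (q.1 i).2)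

theorem measurePreserving_resample (B : Set ι) [DecidablePred (· ∈ B)] :
    MeasurePreserving (resample (Z := Z) B)
      ((Measure.pi fun _ : ι => P.prod P).prod (Measure.pi fun _ : ι => P))
      (Measure.pi fun _ : ι => P.prod P) := by
  have h1 := (measurePreserving_arrowProdEquivProdArrow (Z × Z) Z ι (fun _ => P.prod P)
    fun _ => P).symm
  have h2 : MeasurePreserving (fun (v : ι → (Z × Z) × Z) i =>
      if i ∈ B then (v i).1 else ((v i).2, (v i).1.2))
      (Measure.pi fun _ : ι => (P.prod P).prod P) (Measure.pi fun _ : ι => P.prod P) := by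
    refine measurePreserving_pi (f := fun i (p : (Z × Z) × Z) => if i ∈ B then p.1 else (p.2, p.1.2)) _ _
      fun i => ?_
    by_cases hi : i ∈ B
    · simpa [hi] using measurePreserving_fst
    · simp only [hi, if_false]
      exact ((MeasurePreserving.id P).prod (measurePreserving_snd (μ := P) (ν := P))).comp
        (Measure.measurePreserving_swap (μ := P.prod P) (ν := P))
  exact h2.comp h1

end Preserving

/-! ### Decoupling the folds and bounding the exponential moment -/

section Blocks

set_option linter.unusedSectionVars false

open scoped ENNReal

variable {J K Z : Type*} [Fintype J] [Fintype K] [DecidableEq J] [DecidableEq K]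
  [MeasurableSpace Z] (P : Measure Z) [IsProbabilityMeasure P] (θ : ℝ)
  (g : J → (J × K → Z) → Z → ℝ)

/-- The exponential of the difference of the losses on the two halves of the block `j`, for the
predictor of that block trained on `e`. -/
def blockExp (j : J) (w : J × K → Z × Z) (e : J × K → Z) : ℝ≥0∞ :=
  ENNReal.ofReal (Real.exp (θ * ∑ r, (g j e (w (j, r)).1 - g j e (w (j, r)).2)))

/-- The essential supremum of `blockExp` over the training samples. -/
def blockSup (j : J) (w : J × K → Z × Z) : ℝ≥0∞ :=
  essSup (blockExp θ g j w) (Measure.pi fun _ : J × K => P)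

variable {g}

theorem measurable_blockExp (hg : ∀ j, Measurable fun q : (J × K → Z) × Z => g j q.1 q.2) (j : J) :
    Measurable (Function.uncurry (blockExp θ g j)) := by
  unfold blockExp Function.uncurry
  refine ENNReal.measurable_ofReal.comp (Real.measurable_exp.comp (Measurable.const_mul ?_ _))
  refine Finset.measurable_sum _ fun r _ => Measurable.sub ?_ ?_
  · exact (hg j).comp (f := fun q : (J × K → Z × Z) × (J × K → Z) => (q.2, (q.1 (j, r)).1))
      (by fun_prop)
  · exact (hg j).comp (f := fun q : (J × K → Z × Z) × (J × K → Z) => (q.2, (q.1 (j, r)).2))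
      (by fun_prop)

theorem measurable_blockSup (hg : ∀ j, Measurable fun q : (J × K → Z) × Z => g j q.1 q.2) (j : J) :
    Measurable (blockSup P θ g j) :=
  measurable_essSup_prod _ (measurable_blockExp θ hg j)

/-- As the predictor of a block does not depend on the observations of that block, its own
difference of losses is almost surely dominated by the essential supremum. -/
theorem blockExp_le_blockSup_ae (hg : ∀ j, Measurable fun q : (J × K → Z) × Z => g j q.1 q.2)
    (hg_loc : ∀ j e e', (∀ i : J × K, i.1 ≠ j → e i = e' i) → g j e = g j e') (j : J) :
    ∀ᵐ w ∂(Measure.pi fun _ : J × K => P.prod P),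
      blockExp θ g j w (fun i => (w i).1) ≤ blockSup P θ g j w := by
  classical
  -- Redrawing the first coordinates outside block `j` keeps the law, leaves `blockSup` unchanged,
  -- and makes the training sample independent of the pairs; Fubini then reduces the claim to the
  -- definition of the essential supremum.
  set B : Set (J × K) := {i | i.1 = j} with hB
  have hmp := measurePreserving_resample P B
  have hm1 : Measurable fun w : J × K → Z × Z => blockExp θ g j w (fun i => (w i).1) :=
    (measurable_blockExp θ hg j).comp
      (f := fun w : J × K → Z × Z => (w, fun i => (w i).1)) (by fun_prop)
  rw [← hmp.map_eq, ae_map_iff hmp.measurable.aemeasurable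
    (measurableSet_le hm1 (measurable_blockSup P θ hg j))]
  have key : ∀ (w : J × K → Z × Z) (e e' : J × K → Z),
      blockExp θ g j (resample B (w, e)) e' = blockExp θ g j w e' := fun w e e' => by
    simp [blockExp, resample, hB]
  have hloc : ∀ (w : J × K → Z × Z) (e : J × K → Z),
      blockExp θ g j w (fun i => (resample B (w, e) i).1) = blockExp θ g j w e := fun w e => by
    have : g j (fun i => (resample B (w, e) i).1) = g j e :=
      hg_loc j _ _ fun i hi => by simp [resample, hB, hi]
    simp [blockExp, this]
  have hsup : ∀ (w : J × K → Z × Z) (e : J × K → Z),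
      blockSup P θ g j (resample B (w, e)) = blockSup P θ g j w := fun w e => by
    unfold blockSup
    congr 1
    ext e'
    exact key w e e'
  have hae : ∀ᵐ q ∂((Measure.pi fun _ : J × K => P.prod P).prod (Measure.pi fun _ : J × K => P)),
      blockExp θ g j q.1 q.2 ≤ blockSup P θ g j q.1 := by
    refine (Measure.ae_prod_iff_ae_ae (measurableSet_le (measurable_blockExp θ hg j)
      ((measurable_blockSup P θ hg j).comp measurable_fst))).2 ?_
    exact Filter.Eventually.of_forall fun w => ENNReal.ae_le_essSup _
  filter_upwards [hae] with q hq
  rw [show q = (q.1, q.2) from rfl, key, hloc, hsup]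
  exact hq

variable {𝒜 : Set (Set Z)}

/-- The maximizing trace depends on the signs and on the predictor, so it is bounded by the sum over
all traces, which is free of the predictor. -/
theorem blockSup_swapAt_le (hg01 : ∀ j e z, g j e z ∈ Set.Icc (0 : ℝ) 1)
    (hg𝒜 : ∀ j e, ∀ t ∈ Set.Icc (0 : ℝ) 1, {z | t < g j e z} ∈ 𝒜)
    (j : J) (w : J × K → Z × Z) (σ : J × K → Bool) :
    blockSup P θ g j (swapAt σ w) ≤
      ENNReal.ofReal (∑ T ∈ traces 𝒜 (pairPoints fun r => w (j, r)),
        Real.exp (∑ r, θ * (sgn (σ (j, r)) * pairDiff T r))) := by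
  refine essSup_le_of_ae_le _ (Filter.Eventually.of_forall fun e => ENNReal.ofReal_le_ofReal ?_)
  obtain ⟨T, hT, h⟩ := exists_trace_ge (hg01 j e) (hg𝒜 j e) (fun r => w (j, r))
    (fun r => σ (j, r)) θ
  refine (Real.exp_le_exp.2 h).trans ?_
  exact Finset.single_le_sum
    (f := fun T => Real.exp (∑ r, θ * (sgn (σ (j, r)) * pairDiff T r)))
    (fun _ _ => (Real.exp_pos _).le) hT

theorem sum_prod_traces_le {V : ℕ} (hV : vcDim 𝒜 = V) (w : J × K → Z × Z) :
    ∑ σ : J × K → Bool, ∏ j, ∑ T ∈ traces 𝒜 (pairPoints fun r => w (j, r)),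
        Real.exp (∑ r, θ * (sgn (σ (j, r)) * pairDiff T r)) ≤
      (((2 * Fintype.card K + 1 : ℕ) : ℝ) ^ V * (2 * Real.exp (θ ^ 2 / 2)) ^ Fintype.card K)
        ^ Fintype.card J := by
  -- Signs of distinct blocks vary independently, so the sum over `σ` of the product is a product of
  -- sums.
  rw [← (Equiv.curry J K Bool).symm.sum_comp]
  simp only [Equiv.curry_symm_apply, Function.uncurry_apply_pair]
  rw [← Fintype.piFinset_univ, ← Finset.prod_univ_sum
    (fun _ : J => (Finset.univ : Finset (K → Bool)))
    (fun j τ => ∑ T ∈ traces 𝒜 (pairPoints fun r => w (j, r)),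
      Real.exp (∑ r, θ * (sgn (τ r) * pairDiff T r)))]
  rw [← Finset.card_univ (α := J), ← Finset.prod_const]
  refine Finset.prod_le_prod (fun j _ => Finset.sum_nonneg fun τ _ =>
    Finset.sum_nonneg fun T _ => (Real.exp_pos _).le) fun j _ => ?_
  rw [Finset.sum_comm]
  refine (Finset.sum_le_sum fun T _ => sum_exp_sgn_le _ (abs_pairDiff_le T) θ).trans ?_
  rw [Finset.sum_const, nsmul_eq_mul]
  gcongr
  have h := card_traces_le hV (pairPoints fun r => w (j, r))
  rw [Fintype.card_prod, Fintype.card_bool, mul_comm (Fintype.card K) 2] at h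
  exact_mod_cast h

theorem lintegral_prod_blockSup_le {V : ℕ} (hV : vcDim 𝒜 = V)
    (hg : ∀ j, Measurable fun q : (J × K → Z) × Z => g j q.1 q.2)
    (hg01 : ∀ j e z, g j e z ∈ Set.Icc (0 : ℝ) 1)
    (hg𝒜 : ∀ j e, ∀ t ∈ Set.Icc (0 : ℝ) 1, {z | t < g j e z} ∈ 𝒜) :
    ∫⁻ w, ∏ j, blockSup P θ g j w ∂(Measure.pi fun _ : J × K => P.prod P) ≤
      ENNReal.ofReal ((((2 * Fintype.card K + 1 : ℕ) : ℝ) ^ V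
        * Real.exp (θ ^ 2 / 2) ^ Fintype.card K) ^ Fintype.card J) := by
  set Q := Measure.pi fun _ : J × K => P.prod P
  set c : ℝ := (2 : ℝ) ^ (Fintype.card J * Fintype.card K)
  have hc : 0 < c := by positivity
  have hmeas : Measurable fun w => ∏ j, blockSup P θ g j w :=
    Finset.measurable_prod _ fun j _ => measurable_blockSup P θ hg j
  -- By invariance of the law, averaging over all exchanges leaves the integral unchanged; the sign
  -- sum is then bounded for each fixed `w`.
  have hsum : ∑ _σ : J × K → Bool, ∫⁻ w, ∏ j, blockSup P θ g j w ∂Q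
      = ∫⁻ w, ∑ σ : J × K → Bool, ∏ j, blockSup P θ g j (swapAt σ w) ∂Q := by
    refine Eq.trans ?_ (lintegral_finsetSum _ fun σ _ =>
      hmeas.comp (measurePreserving_swapAt P σ).measurable).symm
    exact Finset.sum_congr rfl fun σ _ =>
      ((measurePreserving_swapAt P σ).lintegral_comp hmeas).symm
  have hpt : ∀ w : J × K → Z × Z, ∑ σ : J × K → Bool, ∏ j, blockSup P θ g j (swapAt σ w) ≤
      ENNReal.ofReal (c * (((2 * Fintype.card K + 1 : ℕ) : ℝ) ^ V
        * Real.exp (θ ^ 2 / 2) ^ Fintype.card K) ^ Fintype.card J) := fun w => by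
    have hnn : ∀ (j : J) (σ : J × K → Bool),
        0 ≤ ∑ T ∈ traces 𝒜 (pairPoints fun r => w (j, r)),
          Real.exp (∑ r, θ * (sgn (σ (j, r)) * pairDiff T r)) :=
      fun j σ => Finset.sum_nonneg fun T _ => (Real.exp_pos _).le
    calc _ ≤ ∑ σ : J × K → Bool, ENNReal.ofReal
            (∏ j, ∑ T ∈ traces 𝒜 (pairPoints fun r => w (j, r)),
              Real.exp (∑ r, θ * (sgn (σ (j, r)) * pairDiff T r))) := by
          refine Finset.sum_le_sum fun σ _ => ?_
          rw [ENNReal.ofReal_prod_of_nonneg fun j _ => hnn j σ]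
          exact Finset.prod_le_prod' fun j _ => blockSup_swapAt_le P θ hg01 hg𝒜 j w σ
      _ ≤ _ := by
          rw [← ENNReal.ofReal_sum_of_nonneg fun σ _ => Finset.prod_nonneg fun j _ => hnn j σ]
          refine ENNReal.ofReal_le_ofReal ((sum_prod_traces_le θ hV w).trans (le_of_eq ?_))
          rw [mul_pow 2, mul_left_comm, mul_pow, ← pow_mul, mul_comm (Fintype.card K)]
  have h := hsum.le.trans (lintegral_mono hpt)
  rw [lintegral_const, measure_univ, mul_one, Finset.sum_const, nsmul_eq_mul,
    ENNReal.ofReal_mul hc.le, Finset.card_univ, Fintype.card_fun, Fintype.card_bool,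
    Fintype.card_prod] at h
  have hc' : ((2 ^ (Fintype.card J * Fintype.card K) : ℕ) : ℝ≥0∞) = ENNReal.ofReal c := by
    rw [← ENNReal.ofReal_natCast]
    simp [c]
  rw [hc'] at h
  exact (ENNReal.mul_le_mul_iff_right (ENNReal.ofReal_pos.2 hc).ne' ENNReal.ofReal_ne_top).1 h

end Blocks

/-! ### Jensen, symmetrization and Markov -/

section Tail

open scoped ENNReal

theorem ofReal_exp_integral_le {α : Type*} [MeasurableSpace α] (ν : Measure α)
    [IsProbabilityMeasure ν] {h : α → ℝ} (hm : Measurable h) {c : ℝ} (hc : ∀ x, |h x| ≤ c) :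
    ENNReal.ofReal (Real.exp (∫ x, h x ∂ν)) ≤ ∫⁻ x, ENNReal.ofReal (Real.exp (h x)) ∂ν := by
  have hi : Integrable h ν :=
    Integrable.of_bound hm.aestronglyMeasurable c (Filter.Eventually.of_forall hc)
  have hie : Integrable (fun x => Real.exp (h x)) ν := by
    refine Integrable.of_bound (Real.measurable_exp.comp hm).aestronglyMeasurable (Real.exp c)
      (Filter.Eventually.of_forall fun x => ?_)
    rw [Real.norm_eq_abs, Real.abs_exp]
    exact Real.exp_le_exp.2 ((le_abs_self _).trans (hc x))
  rw [← ofReal_integral_eq_lintegral_ofReal hie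
    (Filter.Eventually.of_forall fun x => (Real.exp_pos _).le)]
  exact ENNReal.ofReal_le_ofReal (convexOn_exp.map_integral_le Real.continuous_exp.continuousOn
    isClosed_univ (Filter.Eventually.of_forall fun x => Set.mem_univ _) hi hie)

variable {J K Z : Type*} [Fintype J] [Fintype K] [DecidableEq J] [DecidableEq K]
  [MeasurableSpace Z] (P : Measure Z) [IsProbabilityMeasure P] (θ : ℝ)
  {g : J → (J × K → Z) → Z → ℝ} {𝒜 : Set (Set Z)}

/-- Chernoff bound for the deviation between the cross-validated and the true risks, before the
optimization of the parameter `θ`. -/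
theorem measure_deviation_le {V : ℕ} (hV : vcDim 𝒜 = V)
    (hg : ∀ j, Measurable fun q : (J × K → Z) × Z => g j q.1 q.2)
    (hg01 : ∀ j e z, g j e z ∈ Set.Icc (0 : ℝ) 1)
    (hg_loc : ∀ j e e', (∀ i : J × K, i.1 ≠ j → e i = e' i) → g j e = g j e')
    (hg𝒜 : ∀ j e, ∀ t ∈ Set.Icc (0 : ℝ) 1, {z | t < g j e z} ∈ 𝒜) (a : ℝ) :
    (Measure.pi fun _ : J × K => P)
        {d | a ≤ θ * ∑ i, (g i.1 d (d i) - ∫ z, g i.1 d z ∂P)} ≤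
      ENNReal.ofReal (Real.exp (-a) * (((2 * Fintype.card K + 1 : ℕ) : ℝ) ^ V
        * Real.exp (θ ^ 2 / 2) ^ Fintype.card K) ^ Fintype.card J) := by
  set π := Measure.pi fun _ : J × K => P with hπ
  set F : (J × K → Z) × (J × K → Z) → ℝ≥0∞ := fun q =>
    ENNReal.ofReal (Real.exp (θ * ∑ i, (g i.1 q.1 (q.1 i) - g i.1 q.1 (q.2 i)))) with hF
  have hFm : Measurable F := by
    refine ENNReal.measurable_ofReal.comp (Real.measurable_exp.comp (Measurable.const_mul ?_ _))
    refine Finset.measurable_sum _ fun i _ => Measurable.sub ?_ ?_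
    · exact (hg i.1).comp (f := fun q : (J × K → Z) × (J × K → Z) => (q.1, q.1 i)) (by fun_prop)
    · exact (hg i.1).comp (f := fun q : (J × K → Z) × (J × K → Z) => (q.1, q.2 i)) (by fun_prop)
  have hgm : ∀ j d, Measurable (g j d) := fun j d =>
    (hg j).comp (f := fun z => (d, z)) (by fun_prop)
  have hU : Measurable fun d => ∫⁻ d', F (d, d') ∂π := hFm.lintegral_prod_right'
  have hjensen : ∀ d, ENNReal.ofReal (Real.exp (θ * ∑ i, (g i.1 d (d i) - ∫ z, g i.1 d z ∂P))) ≤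
      ∫⁻ d', F (d, d') ∂π := fun d => by
    have hm : ∀ i : J × K, Measurable fun d' : J × K → Z => g i.1 d (d' i) := fun i =>
      (hgm i.1 d).comp (measurable_pi_apply i)
    have hint : ∀ i : J × K, Integrable (fun d' : J × K → Z => g i.1 d (d' i)) π := fun i =>
      Integrable.of_bound (hm i).aestronglyMeasurable 1 (Filter.Eventually.of_forall fun d' => by
        rw [Real.norm_eq_abs, abs_of_nonneg (hg01 _ _ _).1]
        exact (hg01 _ _ _).2)
    have hev : ∀ i : J × K, ∫ d', g i.1 d (d' i) ∂π = ∫ z, g i.1 d z ∂P := fun i => by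
      have hmp := measurePreserving_eval (fun _ : J × K => P) i
      rw [← hmp.map_eq, integral_map hmp.measurable.aemeasurable (hgm i.1 d).aestronglyMeasurable]
    have heq : θ * ∑ i, (g i.1 d (d i) - ∫ z, g i.1 d z ∂P)
        = ∫ d', θ * ∑ i, (g i.1 d (d i) - g i.1 d (d' i)) ∂π := by
      have hint' : ∀ i : J × K, Integrable (fun d' => g i.1 d (d i) - g i.1 d (d' i)) π :=
        fun i => (integrable_const _).sub (hint i)
      rw [integral_const_mul, integral_finsetSum _ fun i _ => hint' i]
      congr 1
      refine Finset.sum_congr rfl fun i _ => ?_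
      rw [integral_sub (integrable_const _) (hint i), hev]
      simp
    rw [heq]
    refine ofReal_exp_integral_le π (c := |θ| * ∑ _i : J × K, 1)
      (Measurable.const_mul (Finset.measurable_sum _ fun i _ => (hm i).const_sub _) _) fun d' => ?_
    rw [abs_mul]
    refine mul_le_mul_of_nonneg_left ((Finset.abs_sum_le_sum_abs _ _).trans
      (Finset.sum_le_sum fun i _ => ?_)) (abs_nonneg _)
    have h1 := hg01 i.1 d (d i)
    have h2 := hg01 i.1 d (d' i)
    rw [abs_le]
    constructor <;> linarith [h1.1, h1.2, h2.1, h2.2]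
  -- Pairing the sample with its ghost identifies the product law with the law of `w`; training uses
  -- the first coordinates.
  have hmoment : ∫⁻ d, ∫⁻ d', F (d, d') ∂π ∂π ≤
      ENNReal.ofReal ((((2 * Fintype.card K + 1 : ℕ) : ℝ) ^ V
        * Real.exp (θ ^ 2 / 2) ^ Fintype.card K) ^ Fintype.card J) := by
    rw [← lintegral_prod _ hFm.aemeasurable,
      ← (measurePreserving_arrowProdEquivProdArrow Z Z (J × K) (fun _ => P)
        fun _ => P).lintegral_comp hFm]
    refine le_trans (lintegral_mono_ae ?_) (lintegral_prod_blockSup_le P θ hV hg hg01 hg𝒜)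
    filter_upwards [ae_all_iff.2 fun j => blockExp_le_blockSup_ae P θ hg hg_loc j] with w hw
    refine le_trans (le_of_eq ?_) (Finset.prod_le_prod' fun j _ => hw j)
    simp only [blockExp]
    rw [← ENNReal.ofReal_prod_of_nonneg fun j _ => (Real.exp_pos _).le, ← Real.exp_sum,
      ← Finset.mul_sum, hF]
    simp only [Fintype.sum_prod_type]
    rfl
  have hsub : {d | a ≤ θ * ∑ i, (g i.1 d (d i) - ∫ z, g i.1 d z ∂P)} ⊆
      {d | ENNReal.ofReal (Real.exp a) ≤ ∫⁻ d', F (d, d') ∂π} := fun d hd =>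
    (ENNReal.ofReal_le_ofReal (Real.exp_le_exp.2 hd)).trans (hjensen d)
  have hmarkov := (mul_meas_ge_le_lintegral (μ := π) hU (ENNReal.ofReal (Real.exp a))).trans hmoment
  calc _ ≤ π {d | ENNReal.ofReal (Real.exp a) ≤ ∫⁻ d', F (d, d') ∂π} := measure_mono hsub
    _ = ENNReal.ofReal (Real.exp (-a)) * (ENNReal.ofReal (Real.exp a)
          * π {d | ENNReal.ofReal (Real.exp a) ≤ ∫⁻ d', F (d, d') ∂π}) := by
      rw [← mul_assoc, ← ENNReal.ofReal_mul (Real.exp_pos _).le, ← Real.exp_add]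
      simp
    _ ≤ _ := by
      rw [ENNReal.ofReal_mul (Real.exp_pos _).le]
      gcongr

end Tail

/-! ### Comparison with the stated constant -/

section Numeric

/-- Comparison of the optimized Chernoff bound with the stated bound, the latter being trivial when
`ε` is small. -/
theorem le_bound_of_le_chernoff {V m k : ℕ} {x ε : ℝ} (hx1 : x ≤ 1)
    (hx : x ≤ Real.exp (-((m * k : ℕ) * ε ^ 2)) *
      (((2 * m + 1 : ℕ) : ℝ) ^ V * Real.exp (ε ^ 2 / 2) ^ m) ^ k) :
    x ≤ (2 : ℝ) ^ (k : ℝ) * Real.exp (-(((m * k : ℕ) : ℝ) * ε ^ 2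
      / (64 * (√((V : ℝ) * Real.log (2 * (2 * (m : ℝ) + 1))) + 2) ^ 2))) := by
  set b := (V : ℝ) * Real.log (2 * (2 * (m : ℝ) + 1)) with hb
  set c := (√b + 2) ^ 2 with hc
  set l := (V : ℝ) * Real.log (2 * (m : ℝ) + 1) with hl
  have hm : (0 : ℝ) ≤ m := Nat.cast_nonneg m
  have hlb : l ≤ b := by
    refine mul_le_mul_of_nonneg_left (Real.log_le_log (by positivity) (by linarith))
      (Nat.cast_nonneg V)
  have hl0 : 0 ≤ l := mul_nonneg (Nat.cast_nonneg V) (Real.log_nonneg (by linarith))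
  have hcb : b + 4 ≤ c := by
    rw [hc, add_sq, Real.sq_sqrt (hl0.trans hlb)]
    nlinarith [Real.sqrt_nonneg b]
  have hlog2 := Real.log_two_gt_d9
  have hrhs : (2 : ℝ) ^ (k : ℝ) * Real.exp (-(((m * k : ℕ) : ℝ) * ε ^ 2 / (64 * c)))
      = Real.exp (k * (Real.log 2 - m * ε ^ 2 / (64 * c))) := by
    rw [Real.rpow_def_of_pos two_pos, ← Real.exp_add]
    push_cast
    ring_nf
  have hlhs : Real.exp (-((m * k : ℕ) * ε ^ 2)) *
      (((2 * m + 1 : ℕ) : ℝ) ^ V * Real.exp (ε ^ 2 / 2) ^ m) ^ k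
      = Real.exp (k * (l - m * ε ^ 2 / 2)) := by
    have h1 : ((2 * m + 1 : ℕ) : ℝ) ^ V = Real.exp l := by
      rw [hl, Real.exp_nat_mul, Real.exp_log (by positivity)]
      push_cast
      ring
    rw [h1, ← Real.exp_nat_mul, ← Real.exp_add, ← Real.exp_nat_mul, ← Real.exp_add]
    push_cast
    ring_nf
  rw [hrhs]
  have hc0 : 0 < 64 * c := by linarith
  have hk : (0 : ℝ) ≤ k := Nat.cast_nonneg k
  -- Below the threshold the stated bound is at least one, since `44 / 64 = 0.6875 < log 2`. Above
  -- it, `l ≤ c < m * ε ^ 2 / 44` is absorbed by `m * ε ^ 2 / 2`, while `64 * c ≥ 256`.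
  rcases le_or_gt (m * ε ^ 2) (44 * c) with h | h
  · refine hx1.trans (Real.one_le_exp (mul_nonneg hk ?_))
    have : m * ε ^ 2 / (64 * c) ≤ 44 / 64 := by
      rw [div_le_div_iff₀ hc0 (by norm_num)]
      linarith
    linarith
  · refine (hx.trans_eq hlhs).trans (Real.exp_le_exp.2 (mul_le_mul_of_nonneg_left ?_ hk))
    have : m * ε ^ 2 / (64 * c) ≤ m * ε ^ 2 / 256 :=
      div_le_div_of_nonneg_left (by positivity) (by norm_num) (by linarith)
    linarith

end Numeric

/-! ### Folds as blocks of a product index -/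

section KFold

variable {𝒳 𝒴 : Type*} {k m : ℕ}

/-- `finProdFinEquiv` sends `(j, r)` to `r + m * j`, whose quotient by the fold size `m` is `j`. -/
theorem finProdFinEquiv_mem_fold (i : Fin k × Fin m) (j : Fin k) :
    finProdFinEquiv i ∈ fold (k * m) k j ↔ i.1 = j := by
  have hm : 0 < m := i.2.pos
  have hk : 0 < k := j.pos
  simp only [fold, Finset.mem_filter, Finset.mem_univ, true_and, finProdFinEquiv_apply_val,
    Nat.mul_div_cancel_left m hk, Nat.add_mul_div_left _ _ hm, Nat.div_eq_of_lt i.2.isLt, zero_add,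
    Fin.ext_iff]

theorem fold_eq_map (j : Fin k) :
    fold (k * m) k j = Finset.univ.map
      ((Function.Embedding.sectR j (Fin m)).trans finProdFinEquiv.toEmbedding) := by
  ext i
  obtain ⟨i, rfl⟩ := finProdFinEquiv.surjective i
  rw [finProdFinEquiv_mem_fold]
  simp only [Finset.mem_map, Finset.mem_univ, true_and, Function.Embedding.trans_apply,
    Function.Embedding.sectR_apply, Equiv.coe_toEmbedding, EmbeddingLike.apply_eq_iff_eq]
  constructor
  · rintro rfl
    exact ⟨i.2, rfl⟩
  · rintro ⟨r, rfl⟩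
    rfl

theorem card_fold (j : Fin k) : (fold (k * m) k j).card = m := by
  rw [fold_eq_map, Finset.card_map, Finset.card_univ, Fintype.card_fin]

theorem sum_fold (j : Fin k) (f : Fin (k * m) → ℝ) :
    ∑ i ∈ fold (k * m) k j, f i = ∑ r, f (finProdFinEquiv (j, r)) := by
  rw [fold_eq_map, Finset.sum_map]
  rfl

theorem expTrain_kFoldLaw (n k : ℕ) [NeZero k] (f : Finset (Fin n) → ℝ) :
    expTrain (kFoldLaw n k) f = (∑ j, f (fold n k j)ᶜ) / k := by
  classical
  have h : ∀ s : Finset (Fin n), (kFoldLaw n k s).toReal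
      = ∑ j : Fin k, if s = (fold n k j)ᶜ then (k : ℝ)⁻¹ else 0 := fun s => by
    rw [kFoldLaw, PMF.map_apply, tsum_fintype, ENNReal.toReal_sum]
    · refine Finset.sum_congr rfl fun j _ => ?_
      split_ifs <;> simp
    · intro j _
      split_ifs <;> simp [NeZero.ne k]
  simp only [expTrain, h, Finset.sum_mul]
  rw [Finset.sum_comm, Finset.sum_div]
  refine Finset.sum_congr rfl fun j _ => ?_
  simp [ite_mul, div_eq_inv_mul]

/-- The loss at a point of the predictor trained outside of the `j`-th fold of the data, where the
data are indexed by the fold and the position in the fold. -/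
def foldLoss (L : 𝒴 → 𝒴 → ℝ) (Φ : Algorithm 𝒳 𝒴) (j : Fin k) (d : Fin k × Fin m → 𝒳 × 𝒴) :
    𝒳 × 𝒴 → ℝ :=
  lossAt L (Φ.trainedOn (fun i => d (finProdFinEquiv.symm i)) (fold (k * m) k j)ᶜ)

theorem cvEstimate_sub_cvRisk [MeasurableSpace 𝒳] [MeasurableSpace 𝒴]
    [NeZero k] [NeZero m] (P : Measure (𝒳 × 𝒴)) (L : 𝒴 → 𝒴 → ℝ)
    (Φ : Algorithm 𝒳 𝒴) (d : Fin (k * m) → 𝒳 × 𝒴) :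
    ((k * m : ℕ) : ℝ) * (cvEstimate L Φ (kFoldLaw (k * m) k) d
        - cvRisk P L Φ (kFoldLaw (k * m) k) d) =
      ∑ i : Fin k × Fin m, (foldLoss L Φ i.1 (fun i => d (finProdFinEquiv i))
          (d (finProdFinEquiv i))
        - ∫ z, foldLoss L Φ i.1 (fun i => d (finProdFinEquiv i)) z ∂P) := by
  have hk : (k : ℝ) ≠ 0 := Nat.cast_ne_zero.2 (NeZero.ne k)
  have hm : (m : ℝ) ≠ 0 := Nat.cast_ne_zero.2 (NeZero.ne m)
  simp only [cvEstimate, cvRisk, expTrain_kFoldLaw, weightedRisk, compl_compl, card_fold, sum_fold,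
    foldLoss, Equiv.apply_symm_apply, Fintype.sum_prod_type, risk, Finset.sum_sub_distrib,
    Finset.sum_const, Finset.card_univ, Fintype.card_fin, nsmul_eq_mul, ← Finset.mul_sum,
    ← Finset.sum_div]
  push_cast
  field_simp

theorem measurable_foldLoss [MeasurableSpace 𝒳] [MeasurableSpace 𝒴]
    {L : 𝒴 → 𝒴 → ℝ} (hL : Measurable (Function.uncurry L))
    {Φ : Algorithm 𝒳 𝒴} (hΦ : Φ.IsMeasurable) (j : Fin k) :
    Measurable fun q : (Fin k × Fin m → 𝒳 × 𝒴) × (𝒳 × 𝒴) => foldLoss L Φ j q.1 q.2 := by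
  set s := (fold (k * m) k j)ᶜ
  have h1 : Measurable fun q : (Fin k × Fin m → 𝒳 × 𝒴) × (𝒳 × 𝒴) =>
      Φ s.card (fun l => q.1 (finProdFinEquiv.symm (s.orderEmbOfFin rfl l))) q.2.1 :=
    (hΦ s.card).comp (f := fun q : (Fin k × Fin m → 𝒳 × 𝒴) × (𝒳 × 𝒴) =>
      ((fun l => q.1 (finProdFinEquiv.symm (s.orderEmbOfFin rfl l))), q.2.1)) (by fun_prop)
  exact hL.comp (f := fun q : (Fin k × Fin m → 𝒳 × 𝒴) × (𝒳 × 𝒴) => (q.2.2,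
    Φ s.card (fun l => q.1 (finProdFinEquiv.symm (s.orderEmbOfFin rfl l))) q.2.1))
    ((measurable_snd.comp measurable_snd).prodMk h1)

theorem foldLoss_congr (L : 𝒴 → 𝒴 → ℝ) (Φ : Algorithm 𝒳 𝒴) (j : Fin k)
    (d d' : Fin k × Fin m → 𝒳 × 𝒴) (h : ∀ i : Fin k × Fin m, i.1 ≠ j → d i = d' i) :
    foldLoss L Φ j d = foldLoss L Φ j d' := by
  unfold foldLoss Algorithm.trainedOn subsample
  congr 2
  funext l
  refine h _ fun hj => ?_
  have hl := Finset.orderEmbOfFin_mem (fold (k * m) k j)ᶜ rfl l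
  rw [Finset.mem_compl] at hl
  exact hl (by rw [← finProdFinEquiv_mem_fold, Equiv.apply_symm_apply] at hj; exact hj)

theorem foldLoss_mem_lossSets {L : 𝒴 → 𝒴 → ℝ} {C : Set (𝒳 → 𝒴)} {Φ : Algorithm 𝒳 𝒴}
    (hΦ : Φ.IsERM L C) (hk : 2 ≤ k) (hm : 0 < m) (j : Fin k) (d : Fin k × Fin m → 𝒳 × 𝒴)
    {t : ℝ} (ht : t ∈ Set.Icc (0 : ℝ) 1) : {z | t < foldLoss L Φ j d z} ∈ lossSets L C := by
  refine ⟨_, (hΦ _ ?_ _).1, t, ht, rfl⟩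
  rw [Finset.card_compl, card_fold, Fintype.card_fin]
  -- With at least two nonempty folds, the training sample is nonempty.
  exact Nat.sub_pos_of_lt (by nlinarith)

end KFold

end CrossVal

end

theorem mainTheorem3
    {𝒳 𝒴 Ω : Type*} [MeasurableSpace 𝒳] [MeasurableSpace 𝒴] [MeasurableSpace Ω]
    (μ : Measure Ω) [IsProbabilityMeasure μ]
    (P : Measure (𝒳 × 𝒴)) [IsProbabilityMeasure P]
    (L : 𝒴 → 𝒴 → ℝ) (hL_meas : Measurable (Function.uncurry L))
    (hL_nonneg : ∀ y y', 0 ≤ L y y') (hL_le_one : ∀ y y', L y y' ≤ 1)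
    (C : Set (𝒳 → 𝒴)) (hC_meas : ∀ φ ∈ C, Measurable φ)
    (V : ℕ) (hV : CrossVal.classVCDim L C = (V : ℕ∞))
    (Φ : CrossVal.Algorithm 𝒳 𝒴) (hΦ_meas : Φ.IsMeasurable) (hΦ_symm : Φ.IsSymmetric)
    (hΦ_erm : Φ.IsERM L C)
    (n k : ℕ) [NeZero k] (hn : 0 < n) (hk : 2 ≤ k) (hkn : k ∣ n)
    (p : ℝ) (hp : p = 1 / (k : ℝ))
    (D : Fin n → Ω → 𝒳 × 𝒴) (hD_meas : ∀ i, Measurable (D i))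
    (hD_law : ∀ i, Measure.map (D i) μ = P) (hD_indep : iIndepFun D μ)
    (ε : ℝ) (hε : 0 < ε) :
    μ.real {ω | ε ≤ CrossVal.cvEstimate L Φ (CrossVal.kFoldLaw n k) (fun i => D i ω)
          - CrossVal.cvRisk P L Φ (CrossVal.kFoldLaw n k) (fun i => D i ω)}
        ≤ (2 : ℝ) ^ (1 / p) * Real.exp (-((n : ℝ) * ε ^ 2
            / (64 * (√((V : ℝ) * Real.log (2 * (2 * (n : ℝ) * p + 1))) + 2) ^ 2)))
    ∧ μ.real {ω | ε ≤ CrossVal.cvRisk P L Φ (CrossVal.kFoldLaw n k) (fun i => D i ω)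
          - CrossVal.cvEstimate L Φ (CrossVal.kFoldLaw n k) (fun i => D i ω)}
        ≤ (2 : ℝ) ^ (1 / p) * Real.exp (-((n : ℝ) * ε ^ 2
            / (64 * (√((V : ℝ) * Real.log (2 * (2 * (n : ℝ) * p + 1))) + 2) ^ 2))) := by
  obtain ⟨m, rfl⟩ := hkn
  have hm : 0 < m := Nat.pos_of_mul_pos_left hn
  have : NeZero m := ⟨hm.ne'⟩
  have hk0 : (k : ℝ) ≠ 0 := Nat.cast_ne_zero.2 (NeZero.ne k)
  have hpk : 1 / p = k := by rw [hp, one_div_one_div]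
  have hnp : 2 * ((k * m : ℕ) : ℝ) * p = 2 * (m : ℝ) := by
    rw [hp]
    push_cast
    field_simp
  have hmap : μ.map (fun ω (i : Fin k × Fin m) => D (finProdFinEquiv i) ω)
      = Measure.pi fun _ => P := by
    rw [(iIndepFun_iff_map_fun_eq_pi_map fun i : Fin k × Fin m =>
      (hD_meas (finProdFinEquiv i)).aemeasurable).1 (hD_indep.precomp finProdFinEquiv.injective)]
    simp only [hD_law]
  -- Both tails at once: `θ = ε` or `θ = -ε`, at level `n ε²`. The choice `|θ| = ε` minimizes the
  -- exponent `n (θ² / 2 - |θ| ε)`.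
  have key : ∀ θ : ℝ, θ ^ 2 = ε ^ 2 → ∀ S : Set Ω,
      (∀ ω ∈ S, ((k * m : ℕ) : ℝ) * ε ^ 2 ≤ θ * (((k * m : ℕ) : ℝ) *
        (CrossVal.cvEstimate L Φ (CrossVal.kFoldLaw (k * m) k) (fun i => D i ω)
          - CrossVal.cvRisk P L Φ (CrossVal.kFoldLaw (k * m) k) (fun i => D i ω)))) →
      μ.real S ≤ (2 : ℝ) ^ (1 / p) * Real.exp (-(((k * m : ℕ) : ℝ) * ε ^ 2
        / (64 * (√((V : ℝ) * Real.log (2 * (2 * ((k * m : ℕ) : ℝ) * p + 1))) + 2) ^ 2))) := by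
    intro θ hθ S hS
    have h := CrossVal.measure_deviation_le P θ hV
      (fun j => CrossVal.measurable_foldLoss hL_meas hΦ_meas (m := m) j)
      (fun j e z => ⟨hL_nonneg _ _, hL_le_one _ _⟩) (CrossVal.foldLoss_congr L Φ)
      (fun j e t ht => CrossVal.foldLoss_mem_lossSets hΦ_erm hk hm j e ht)
      (((k * m : ℕ) : ℝ) * ε ^ 2)
    rw [← hmap] at h
    -- `Measure.le_map_apply` holds for arbitrary sets, so measurability of the deviation event is
    -- not required.
    have h2 := ((measure_mono (s := S) fun ω hω => ?_).trans (Measure.le_map_apply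
      (aemeasurable_pi_lambda _ fun i : Fin k × Fin m =>
        (hD_meas (finProdFinEquiv i)).aemeasurable) _)).trans h
    · rw [hpk, hnp, mul_comm k m]
      refine CrossVal.le_bound_of_le_chernoff measureReal_le_one ?_
      rw [hθ, Fintype.card_fin, Fintype.card_fin, mul_comm k m] at h2
      exact ENNReal.toReal_le_of_le_ofReal (by positivity) h2
    · have := hS ω hω
      rw [CrossVal.cvEstimate_sub_cvRisk] at this
      exact this
  have hkm : (0 : ℝ) ≤ ((k * m : ℕ) : ℝ) := Nat.cast_nonneg _
  constructor
  · refine key ε rfl _ fun ω hω => ?_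
    have := mul_le_mul_of_nonneg_left (Set.mem_ofPred_eq ▸ hω : ε ≤ _) (mul_nonneg hkm hε.le)
    linarith
  · refine key (-ε) (neg_sq ε) _ fun ω hω => ?_
    have := mul_le_mul_of_nonneg_left (Set.mem_ofPred_eq ▸ hω : ε ≤ _) (mul_nonneg hkm hε.le)
    linarith
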